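/- For a system of parties with local dimensions $d_1,\dots,d_N$, a normalized vector $\psi\in\mathbb C^{d_1}\otimes\dots\otimes\mathbb C^{d_N}$ is called $l$-uniform if, for every $l$-element set $S$ of parties, the partial trace of $|\psi\rangle\langle\psi|$ over all parties outside $S$ equals $\bigl(\prod_{i\in S}d_i\bigr)^{-1}I_S$; a subspace is called $l$-uniform if all its normalized vectors are $l$-uniform. An $((n,K,d))_D$ quantum error correcting code is a $K$-dimensional subspace $C$ of $(\mathbb C^D)^{\otimes n}$ such that for every error operator $E=A_1\otimes\dots\otimes A_n$ with fewer than $d$ non-identity factors there is a scalar $c(E)$ with $\langle\varphi|E|\chi\rangle=c(E)\langle\varphi|\chi\rangle$ for all $\varphi,\chi\in C$. It is called a QMDS code if it attains the quantum Singleton bound, i.e. $K=D^{\,n-2(d-1)}$. Let $((n_1,K_1,d_1))_{D_1}$ and $((n_2,K_2,d_2))_{D_2}$ be two QMDS codes with $d_1,d_2\geq 1$ and $K_1=K_2>1$. Put $r_1=d_1-1$ and $r_2=d_2-1$. Then for all integers $0\le\alpha\le r_1$ and $0\le\beta\le r_2$ there exists an $l$-uniform subspace $W$ of $(\mathbb C^{D_1})^{\otimes(n_1-\alpha)}\otimes(\mathbb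 C^{D_2})^{\otimes(n_2-\beta)}$ such that $$\dim W=D_1^{\alpha}D_2^{\beta},\qquad l=\min\bigl(n_1-r_1-\alpha,\;n_2-r_2-\beta,\;r_1+r_2+1-\alpha-\beta\bigr).$$ -/

import Mathlib

noncomputable section

/-- The Hilbert space `ℂ^{d i₁} ⊗ ⋯ ⊗ ℂ^{d iₙ}` of a system of parties indexed by `ι`, where party
`i` has local dimension `d i`: vectors are given by their coordinates in the computational (product)
basis, which is indexed by the tuples `x` with `x i ∈ {0, …, d i - 1}`. -/
abbrev StateSpace {ι : Type*} [Fintype ι] (d : ι → ℕ) : Type _ :=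
  EuclideanSpace ℂ (∀ i, Fin (d i))

/-- The basis index of the whole system with entries `x` on the parties in `S` and entries `z` on
the remaining parties. -/
def glueIndex {ι : Type*} [DecidableEq ι] {d : ι → ℕ} (S : Finset ι)
    (x : ∀ i : {i // i ∈ S}, Fin (d i)) (z : ∀ i : {i // i ∉ S}, Fin (d i)) :
    ∀ i, Fin (d i) :=
  fun i => if h : i ∈ S then x ⟨i, h⟩ else z ⟨i, h⟩

/-- The partial trace over all parties outside `S`: the reduction of an operator `ρ` to the parties
in `S`. -/
def reduction {ι : Type*} [Fintype ι] [DecidableEq ι] {d : ι → ℕ} (S : Finset ι)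
    (ρ : Matrix (∀ i, Fin (d i)) (∀ i, Fin (d i)) ℂ) :
    Matrix (∀ i : {i // i ∈ S}, Fin (d i)) (∀ i : {i // i ∈ S}, Fin (d i)) ℂ :=
  fun x y => ∑ z : (∀ i : {i // i ∉ S}, Fin (d i)), ρ (glueIndex S x z) (glueIndex S y z)

/-- The operator `|ψ⟩⟨ψ|`. -/
def dyad {ι : Type*} [Fintype ι] {d : ι → ℕ} (ψ : StateSpace d) :
    Matrix (∀ i, Fin (d i)) (∀ i, Fin (d i)) ℂ :=
  fun x y => ψ x * star (ψ y)

/-- A state (normalized vector) is `r`-uniform if its reduction to any `r` parties is maximally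
mixed. -/
def IsUniformState {ι : Type*} [Fintype ι] [DecidableEq ι] {d : ι → ℕ} (r : ℕ)
    (ψ : StateSpace d) : Prop :=
  ‖ψ‖ = 1 ∧ ∀ S : Finset ι, S.card = r →
    reduction S (dyad ψ) = (∏ i ∈ S, (d i : ℂ))⁻¹ • (1 : Matrix _ _ ℂ)

/-- A subspace is `r`-uniform if all its states (normalized vectors) are `r`-uniform. -/
def IsUniformSubspace {ι : Type*} [Fintype ι] [DecidableEq ι] {d : ι → ℕ} (r : ℕ)
    (W : Submodule ℂ (StateSpace d)) : Prop :=
  ∀ ψ ∈ W, ‖ψ‖ = 1 → IsUniformState r ψ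

/-- The error operator `A 1 ⊗ ⋯ ⊗ A n` on `(ℂ^D)^{⊗ n}`. -/
def errorOperator {n D : ℕ} (A : Fin n → Matrix (Fin D) (Fin D) ℂ) :
    Matrix (Fin n → Fin D) (Fin n → Fin D) ℂ :=
  fun x y => ∏ i, A i (x i) (y i)

/-- The weight of the error operator `A 1 ⊗ ⋯ ⊗ A n`: the number of parties on which it acts
by something else than the identity. -/
def errorWeight {n D : ℕ} (A : Fin n → Matrix (Fin D) (Fin D) ℂ) : ℕ :=
  Set.ncard {i | A i ≠ 1}

/-- `C` is an `((n, K, dist))_D` quantum error correcting code: a `K`-dimensional subspace of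
`(ℂ^D)^{⊗ n}` that detects every error operator `E` of weight less than `dist`, that is, which
satisfies the Knill-Laflamme condition `⟨φ|E|χ⟩ = c(E) ⟨φ|χ⟩` on the code space. -/
structure IsQuantumCode {n D : ℕ} (C : Submodule ℂ (StateSpace fun _ : Fin n => D))
    (K dist : ℕ) : Prop where
  finrank_eq : Module.finrank ℂ C = K
  detects : ∀ A : Fin n → Matrix (Fin D) (Fin D) ℂ, errorWeight A < dist →
    ∃ c : ℂ, ∀ φ ∈ C, ∀ χ ∈ C,
      inner ℂ φ (Matrix.toEuclideanLin (errorOperator A) χ) = c * inner ℂ φ χ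

/-- A quantum maximum distance separable code: an `((n, K, dist))_D` code that attains the quantum
Singleton bound `K ≤ D ^ (n - 2 (dist - 1))`. -/
def IsQMDSCode {n D : ℕ} (C : Submodule ℂ (StateSpace fun _ : Fin n => D)) (K dist : ℕ) : Prop :=
  IsQuantumCode C K dist ∧ (K : ℝ) = (D : ℝ) ^ ((n : ℤ) - 2 * ((dist : ℤ) - 1))

end

/-!
Let `K` be the common dimension of the two codes, with orthonormal bases `φ k` and `χ k`. The
subspace `W` consists of the projections `⟨a|ψ⟩` of the entangled state `ψ = ∑ k, φ k ⊗ χ k` onto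
the vectors `a` of `α` parties of the first and `β` parties of the second system. A reduction of
`⟨a|ψ⟩` to a set `S` is a block of the reduction of `ψ` to `S` and the projected parties, so it
suffices that the latter is maximally mixed. If that set meets one of the codes in at most `r`
parties, where `r` is its distance minus one, then by the Knill–Laflamme condition only the terms
`|φ k⟩⟨φ k| ⊗ |χ k⟩⟨χ k|` of `|ψ⟩⟨ψ|` contribute, all with the same reduction in that code, and what
remains is the product of this reduction and a reduction of the projection onto the other code
(`overlap_entangledState`, `sum_sum_ite_mul`).

Thus one needs that quantum MDS codes on `n` parties are pure, and that their projections have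
maximally mixed reductions to `n - r` parties (`IsQMDSCode.exists_overlap_eq`). Write `ρ` for the
normalized code projection. For a set `A` of `r` parties the Knill–Laflamme condition gives
`tr ρ_{Aᶜ} ^ 2 = tr ρ_A ^ 2 / K` (`mul_purity_compl`). For another such set `A'` disjoint from `A`,
let `B` be the `n - 2 r` remaining parties. The squared Hilbert–Schmidt distance of `ρ_{Aᶜ}` from
`ρ_{A'} ⊗ I_B / D ^ (n - 2 r)` is `tr ρ_{Aᶜ} ^ 2 - tr ρ_{A'} ^ 2 / D ^ (n - 2 r)`
(`sum_sub_indicator_mul_conj`), which equals `(tr ρ_A ^ 2 - tr ρ_{A'} ^ 2) / K` as the code attains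
the Singleton bound. By symmetry this vanishes, so `ρ_{Aᶜ} = ρ_{A'} ⊗ I_B / D ^ (n - 2 r)`
(`totalOverlap_compl_eq`). As `K > 1` means `n > 2 r`, every party of `Aᶜ` belongs to `B` for a
suitable choice of `A'`, and hence `ρ_{Aᶜ}` is maximally mixed.
-/

open Finset ComplexConjugate

/-! ### Overlaps: partial traces without subsystem indices -/

section Overlap

variable {ι : Type*} [Fintype ι] [DecidableEq ι] {κ : ι → Type*} [∀ i, Fintype (κ i)]

/-- The partial trace of `|f⟩⟨g|` over the parties outside `T`, up to the factor `∏ i ∈ T, |κ i|`.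
The rows and columns `x`, `y` are full basis indices of which only the entries in `T` matter, and
the sum runs over full indices `z` as well, so that every term occurs `∏ i ∈ T, |κ i|` times. With
this normalization, the reduction is a multiple of the identity iff
`overlap T f g x y = ⟨g, f⟩ * [x = y on T]`, whatever the size of `T`. -/
def overlap (T : Finset ι) (f g : (∀ i, κ i) → ℂ) (x y : ∀ i, κ i) : ℂ :=
  ∑ z : ∀ i, κ i, f (T.piecewise x z) * conj (g (T.piecewise y z))

theorem sum_rotate {σ τ υ : Type*} [Fintype σ] [Fintype τ] [Fintype υ] (H : σ → τ → υ → ℂ) :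
    ∑ w, ∑ x, ∑ y, H w x y = ∑ x, ∑ y, ∑ w, H w x y := by
  rw [Finset.sum_comm]
  exact Finset.sum_congr rfl fun x _ => Finset.sum_comm

/-- Exchanging the entries in `T` between two indices is a bijection on pairs of indices. -/
theorem sum_piecewise_swap (T : Finset ι) (H : (∀ i, κ i) → (∀ i, κ i) → ℂ) :
    ∑ w, ∑ z, H (T.piecewise w z) (T.piecewise z w) = ∑ w, ∑ z, H w z := by
  have key : Function.Involutive
      (fun p : (∀ i, κ i) × (∀ i, κ i) => (T.piecewise p.1 p.2, T.piecewise p.2 p.1)) := by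
    rintro ⟨w, z⟩
    ext i <;> by_cases hi : i ∈ T <;> simp [hi]
  rw [← Fintype.sum_prod_type', ← Fintype.sum_prod_type']
  exact Fintype.sum_bijective _ key.bijective _ _ fun _ => rfl

theorem sum_sum_piecewise (T : Finset ι) (F : (∀ i, κ i) → ℂ) :
    ∑ w, ∑ z, F (T.piecewise w z) = (Fintype.card (∀ i, κ i) : ℂ) * ∑ z, F z := by
  rw [sum_piecewise_swap T fun w _ => F w]
  simp [Finset.mul_sum]

theorem overlap_congr {T : Finset ι} (f g : (∀ i, κ i) → ℂ) {x x' y y' : ∀ i, κ i}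
    (hx : ∀ i ∈ T, x i = x' i) (hy : ∀ i ∈ T, y i = y' i) :
    overlap T f g x y = overlap T f g x' y' := by
  have h : ∀ {x x' : ∀ i, κ i} (z : ∀ i, κ i), (∀ i ∈ T, x i = x' i) →
      T.piecewise x z = T.piecewise x' z := by
    intro x x' z h
    ext i
    by_cases hi : i ∈ T <;> simp [hi, h i]
  simp only [overlap, h _ hx, h _ hy]

theorem overlap_empty (f g : (∀ i, κ i) → ℂ) (x y : ∀ i, κ i) :
    overlap ∅ f g x y = ∑ z, f z * conj (g z) := by
  simp [overlap]

theorem sum_overlap_self (T : Finset ι) (f : (∀ i, κ i) → ℂ) :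
    ∑ x, overlap T f f x x = (Fintype.card (∀ i, κ i) : ℂ) * ∑ z, f z * conj (f z) :=
  sum_sum_piecewise T fun z => f z * conj (f z)

theorem overlap_sum_mul {σ τ : Type*} [Fintype σ] [Fintype τ] (T : Finset ι)
    (a : σ → ℂ) (b : τ → ℂ) (f : σ → (∀ i, κ i) → ℂ) (g : τ → (∀ i, κ i) → ℂ)
    (x y : ∀ i, κ i) :
    overlap T (fun v => ∑ s, a s * f s v) (fun v => ∑ t, b t * g t v) x y =
      ∑ s, ∑ t, a s * conj (b t) * overlap T (f s) (g t) x y := by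
  simp only [overlap, map_sum, map_mul, Finset.sum_mul_sum]
  simp only [Finset.mul_sum]
  rw [Finset.sum_comm]
  refine Finset.sum_congr rfl fun s _ => ?_
  rw [Finset.sum_comm]
  refine Finset.sum_congr rfl fun t _ => Finset.sum_congr rfl fun z _ => ?_
  ring

/-- Tracing out the parties in `B` from the reduction to `M = A ∪ B` gives the reduction to `A`. -/
theorem sum_overlap_piecewise {M A B : Finset ι} (hM : ∀ i, i ∈ M ↔ i ∈ A ∨ i ∈ B)
    (hAB : Disjoint A B) (f g : (∀ i, κ i) → ℂ) (x y : ∀ i, κ i) :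
    ∑ w, overlap M f g (B.piecewise w x) (B.piecewise w y) =
      (Fintype.card (∀ i, κ i) : ℂ) * overlap A f g x y := by
  have h : ∀ w z x : ∀ i, κ i,
      M.piecewise (B.piecewise w x) z = A.piecewise x (B.piecewise w z) := by
    intro w z x
    ext i
    have hi := hM i
    have hd : i ∈ A → i ∉ B := fun h => Finset.disjoint_left.1 hAB h
    by_cases hA : i ∈ A <;> by_cases hB : i ∈ B <;> simp_all [Finset.piecewise]
  simp only [overlap, h]
  exact sum_sum_piecewise B fun v => f (A.piecewise x v) * conj (g (A.piecewise y v))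

/-- The Hilbert–Schmidt product of the reductions of `|f⟩⟨f|` and `|g⟩⟨g|` to the complement of `T`
equals the squared Hilbert–Schmidt norm of the reduction of `|f⟩⟨g|` to `T`. -/
theorem sum_overlap_mul_conj_compl (T : Finset ι) (f g : (∀ i, κ i) → ℂ) :
    ∑ x, ∑ y, overlap Tᶜ f f x y * conj (overlap Tᶜ g g x y) =
      ∑ x, ∑ y, overlap T f g x y * conj (overlap T f g x y) := by
  have h : ∀ x z : ∀ i, κ i, Tᶜ.piecewise x z = T.piecewise z x := fun x z => by
    ext i
    by_cases hi : i ∈ T <;> simp [hi]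
  simp only [overlap, h, map_sum, map_mul, Complex.conj_conj, Finset.sum_mul_sum]
  rw [sum_rotate, sum_rotate]
  refine Finset.sum_congr rfl fun z _ => ?_
  rw [← sum_rotate]
  refine Finset.sum_congr rfl fun w _ => Finset.sum_congr rfl fun x _ =>
    Finset.sum_congr rfl fun y _ => ?_
  ring

variable [∀ i, DecidableEq (κ i)]

/-- An index which agrees with `x` on `T` is `T.piecewise x z` for exactly `∏ i ∈ T, |κ i|` many
indices `z`. -/
theorem sum_piecewise_univ (T : Finset ι) (f : (∀ i, κ i) → ℂ) (x : ∀ i, κ i) :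
    ∑ z, f (T.piecewise x z) =
      (∏ i ∈ T, (Fintype.card (κ i) : ℂ)) * ∑ u, if ∀ i ∈ T, x i = u i then f u else 0 := by
  have hfib : ∀ u : ∀ i, κ i, ((univ.filter fun z => T.piecewise x z = u).card : ℂ) =
      if ∀ i ∈ T, x i = u i then ∏ i ∈ T, (Fintype.card (κ i) : ℂ) else 0 := by
    intro u
    split_ifs with h
    · have : (univ.filter fun z => T.piecewise x z = u) =
          Fintype.piFinset fun i => if i ∈ T then univ else {u i} := by
        ext z
        simp only [mem_filter, mem_univ, true_and, Fintype.mem_piFinset, funext_iff]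
        refine forall_congr' fun i => ?_
        by_cases hi : i ∈ T <;> simp [hi, h i]
      rw [this, Fintype.card_piFinset]
      push_cast
      rw [← Finset.prod_subset (Finset.subset_univ T)]
      · exact Finset.prod_congr rfl fun i hi => by simp [hi]
      · intro i _ hi
        simp [hi]
    · have : (univ.filter fun z => T.piecewise x z = u) = ∅ := by
        refine Finset.filter_eq_empty_iff.2 fun z _ hz => h fun i hi => ?_
        rw [← hz, Finset.piecewise_eq_of_mem _ _ _ hi]
      simp [this]
  rw [← Finset.sum_fiberwise (s := univ) (g := fun z => T.piecewise x z), Finset.mul_sum]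
  refine Finset.sum_congr rfl fun u _ => ?_
  rw [Finset.sum_congr rfl (g := fun _ => f u)
    (fun z hz => by rw [(Finset.mem_filter.1 hz).2]), Finset.sum_const, nsmul_eq_mul, hfib u]
  split_ifs <;> simp

theorem sum_sum_sum_piecewise (B : Finset ι) (H : (∀ i, κ i) → (∀ i, κ i) → ℂ) :
    ∑ w, ∑ x, ∑ y, H (B.piecewise w x) (B.piecewise w y) =
      (Fintype.card (∀ i, κ i) : ℂ) * ((∏ i ∈ B, (Fintype.card (κ i) : ℂ)) *
        ∑ x, ∑ y, if ∀ i ∈ B, x i = y i then H x y else 0) := by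
  have h : ∀ w x y : ∀ i, κ i, B.piecewise w y = B.piecewise (B.piecewise w x) y := by
    intro w x y
    ext i
    by_cases hi : i ∈ B <;> simp [hi]
  calc _ = ∑ w, ∑ x, (fun v => ∑ y, H v (B.piecewise v y)) (B.piecewise w x) := by
        refine Finset.sum_congr rfl fun w _ => Finset.sum_congr rfl fun x _ =>
          Finset.sum_congr rfl fun y _ => ?_
        rw [← h]
    -- Swapping the entries in `B` of `w` and `x` turns `B.piecewise w x` into a free index.
    _ = _ := by
        rw [sum_sum_piecewise B fun v => ∑ y, H v (B.piecewise v y)]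
        simp_rw [sum_piecewise_univ, Finset.mul_sum]

/-- Pythagoras for the partial trace: if `G` is the operator obtained from `F` by tracing out `B`
and `G ⊗ I` is its extension by the normalized identity on `B`, then `F - G ⊗ I` is orthogonal to
`G ⊗ I` for the Hilbert–Schmidt product. -/
theorem sum_sub_indicator_mul_conj [∀ i, Nonempty (κ i)] (B : Finset ι)
    (F G : (∀ i, κ i) → (∀ i, κ i) → ℂ)
    (hG : ∀ w x y, G (B.piecewise w x) (B.piecewise w y) = G x y)
    (hFG : ∀ x y, ∑ w, F (B.piecewise w x) (B.piecewise w y) =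
      (Fintype.card (∀ i, κ i) : ℂ) * G x y) :
    (∏ i ∈ B, (Fintype.card (κ i) : ℂ)) *
      ∑ x, ∑ y, (F x y - if ∀ i ∈ B, x i = y i then G x y else 0) *
        conj (F x y - if ∀ i ∈ B, x i = y i then G x y else 0) =
      (∏ i ∈ B, (Fintype.card (κ i) : ℂ)) * (∑ x, ∑ y, F x y * conj (F x y)) -
        ∑ x, ∑ y, G x y * conj (G x y) := by
  have hN : (Fintype.card (∀ i, κ i) : ℂ) ≠ 0 := by
    exact_mod_cast Fintype.card_ne_zero
  have hFG' : ∀ x y, ∑ w, conj (F (B.piecewise w x) (B.piecewise w y)) =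
      (Fintype.card (∀ i, κ i) : ℂ) * conj (G x y) := by
    intro x y
    rw [← map_sum, hFG, map_mul, map_natCast]
  have h1 := sum_sum_sum_piecewise B fun x y => F x y * conj (G x y)
  have h2 := sum_sum_sum_piecewise B fun x y => G x y * conj (F x y)
  have h3 := sum_sum_sum_piecewise B fun x y => G x y * conj (G x y)
  rw [sum_rotate] at h1 h2 h3
  simp only [hG] at h1 h2 h3
  simp only [← Finset.sum_mul, ← Finset.mul_sum, hFG, hFG', Finset.sum_const, card_univ,
    nsmul_eq_mul] at h1 h2 h3
  have h1' : ∑ x, ∑ y, G x y * conj (G x y) = (∏ i ∈ B, (Fintype.card (κ i) : ℂ)) *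
      ∑ x, ∑ y, if ∀ i ∈ B, x i = y i then F x y * conj (G x y) else 0 :=
    mul_left_cancel₀ hN (by rw [← h1]; simp only [Finset.mul_sum, mul_assoc])
  have h2' : ∑ x, ∑ y, G x y * conj (G x y) = (∏ i ∈ B, (Fintype.card (κ i) : ℂ)) *
      ∑ x, ∑ y, if ∀ i ∈ B, x i = y i then G x y * conj (F x y) else 0 :=
    mul_left_cancel₀ hN (by rw [← h2]; simp only [Finset.mul_sum, mul_left_comm (G _ _)])
  have h3' : ∑ x, ∑ y, G x y * conj (G x y) = (∏ i ∈ B, (Fintype.card (κ i) : ℂ)) *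
      ∑ x, ∑ y, if ∀ i ∈ B, x i = y i then G x y * conj (G x y) else 0 :=
    mul_left_cancel₀ hN (by rw [← h3]; simp only [Finset.mul_sum, mul_assoc])
  -- By `h1'`, `h2'`, `h3'` the last three terms of the expansion have the same sum up to sign.
  have hexp : ∀ x y, (F x y - if ∀ i ∈ B, x i = y i then G x y else 0) *
        conj (F x y - if ∀ i ∈ B, x i = y i then G x y else 0) =
      F x y * conj (F x y) - (if ∀ i ∈ B, x i = y i then F x y * conj (G x y) else 0) -
        (if ∀ i ∈ B, x i = y i then G x y * conj (F x y) else 0) +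
        (if ∀ i ∈ B, x i = y i then G x y * conj (G x y) else 0) := by
    intro x y
    split_ifs
    · rw [map_sub]; ring
    · simp
  simp only [hexp, Finset.sum_add_distrib, Finset.sum_sub_distrib]
  linear_combination h1' + h2' - h3'

end Overlap

/-! ### Reductions of quantum MDS codes -/

section Code

/-- An orthonormal basis of the code space, with the Knill–Laflamme condition expressed by
reductions: for `|T| ≤ r` the reduction of `|φ k⟩⟨φ l|` to `T` is zero for `k ≠ l` and does not
depend on `k` for `k = l`. -/
theorem exists_overlap_eq_of_isQuantumCode {n D K r : ℕ}
    {C : Submodule ℂ (StateSpace fun _ : Fin n => D)} (hC : IsQuantumCode C K (r + 1)) :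
    ∃ φ : Fin K → (Fin n → Fin D) → ℂ,
      (∀ k l, ∑ z, φ k z * conj (φ l z) = if k = l then 1 else 0) ∧
      ∀ T : Finset (Fin n), T.card ≤ r → ∀ x y : Fin n → Fin D, ∃ c : ℂ, ∀ k l,
        overlap T (φ k) (φ l) x y = if k = l then c else 0 := by
  obtain ⟨b⟩ : Nonempty (OrthonormalBasis (Fin K) ℂ C) :=
    ⟨(stdOrthonormalBasis ℂ C).reindex (finCongr hC.finrank_eq)⟩
  have hb : ∀ k l, ∑ z, (b k : StateSpace fun _ : Fin n => D) z * conj ((b l).1 z) =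
      if k = l then 1 else 0 := by
    intro k l
    have h := orthonormal_iff_ite.1 b.orthonormal l k
    rw [Submodule.coe_inner, PiLp.inner_apply] at h
    simp only [RCLike.inner_apply] at h
    rw [h]
    simp only [eq_comm]
  refine ⟨fun k z => (b k).1 z, hb, fun T hT x y => ?_⟩
  -- The matrix unit `|y⟩⟨x|` on the parties in `T` reads off one entry of the reduction to `T`.
  set A : Fin n → Matrix (Fin D) (Fin D) ℂ :=
    fun i => if i ∈ T then Matrix.single (y i) (x i) 1 else 1 with hA
  have hw : errorWeight A < r + 1 := by
    refine Nat.lt_succ_of_le (le_trans ?_ hT)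
    rw [errorWeight, ← Set.ncard_coe_finset T]
    refine Set.ncard_le_ncard (fun i hi => ?_) T.finite_toSet
    by_contra h
    exact hi (if_neg h)
  have hE : ∀ u v : Fin n → Fin D, errorOperator A u v =
      if ∀ i ∈ T, y i = u i then if T.piecewise x u = v then 1 else 0 else 0 := by
    intro u v
    have hAi : ∀ i, A i (u i) (v i) =
        if (i ∈ T → y i = u i) ∧ T.piecewise x u i = v i then 1 else 0 := by
      intro i
      by_cases hi : i ∈ T
      · simp [hA, hi, Matrix.single_apply]
      · simp [hA, hi, Matrix.one_apply]
    simp only [errorOperator, hAi]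
    rw [← ite_and]
    split_ifs with h
    · exact Finset.prod_eq_one fun i _ => if_pos ⟨h.1 i, congrFun h.2 i⟩
    · by_contra hne
      have hall : ∀ i, (i ∈ T → y i = u i) ∧ T.piecewise x u i = v i := by
        intro i
        by_contra hi
        exact hne (Finset.prod_eq_zero (mem_univ i) (if_neg hi))
      exact h ⟨fun i => (hall i).1, funext fun i => (hall i).2⟩
  obtain ⟨c, hc⟩ := hC.detects A hw
  refine ⟨(∏ i ∈ T, (Fintype.card (Fin D) : ℂ)) * c, fun k l => ?_⟩
  have h := hc _ (b l).2 _ (b k).2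
  rw [PiLp.inner_apply, PiLp.inner_apply] at h
  simp only [RCLike.inner_apply, hb] at h
  let F : (Fin n → Fin D) → ℂ := fun u => (b k).1 (T.piecewise x u) * conj ((b l).1 u)
  have hov : overlap T (fun z => (b k).1 z) (fun z => (b l).1 z) x y =
      ∑ z, F (T.piecewise y z) := by
    refine Finset.sum_congr rfl fun z _ => ?_
    have : T.piecewise x (T.piecewise y z) = T.piecewise x z := by
      ext i
      by_cases hi : i ∈ T <;> simp [hi]
    simp only [F, this]
  rw [hov, sum_piecewise_univ]
  rw [show (if k = l then (∏ i ∈ T, (Fintype.card (Fin D) : ℂ)) * c else 0) =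
    (∏ i ∈ T, (Fintype.card (Fin D) : ℂ)) * (c * if k = l then 1 else 0) by split_ifs <;> simp]
  simp only [mul_ite, mul_one, mul_zero] at h ⊢
  rw [← mul_ite_zero, ← h]
  congr 1
  refine Finset.sum_congr rfl fun u _ => ?_
  rw [Matrix.toLpLin_apply]
  simp only [Matrix.mulVec, dotProduct, hE]
  split_ifs <;> simp [F]

variable {ι : Type*} [Fintype ι] [DecidableEq ι] {D K r : ℕ}

/-- The reduction to `T` of the projection `∑ k, |φ k⟩⟨φ k|` onto the code space, normalized as in
`overlap`: it is maximally mixed iff `totalOverlap φ T x y = K * [x = y on T]`. -/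
def totalOverlap (φ : Fin K → (ι → Fin D) → ℂ) (T : Finset ι) (x y : ι → Fin D) : ℂ :=
  ∑ k, overlap T (φ k) (φ k) x y

theorem totalOverlap_congr (φ : Fin K → (ι → Fin D) → ℂ) {T : Finset ι} {x x' y y' : ι → Fin D}
    (hx : ∀ i ∈ T, x i = x' i) (hy : ∀ i ∈ T, y i = y' i) :
    totalOverlap φ T x y = totalOverlap φ T x' y' :=
  Finset.sum_congr rfl fun _ _ => overlap_congr _ _ hx hy

theorem sum_totalOverlap_piecewise (φ : Fin K → (ι → Fin D) → ℂ) {M A B : Finset ι}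
    (hM : ∀ i, i ∈ M ↔ i ∈ A ∨ i ∈ B) (hAB : Disjoint A B) (x y : ι → Fin D) :
    ∑ w, totalOverlap φ M (B.piecewise w x) (B.piecewise w y) =
      (Fintype.card (ι → Fin D) : ℂ) * totalOverlap φ A x y := by
  simp only [totalOverlap]
  rw [Finset.sum_comm, Finset.mul_sum]
  exact Finset.sum_congr rfl fun k _ => sum_overlap_piecewise hM hAB _ _ _ _

/-- The purity `tr ρ ^ 2` of the reduction `ρ` to `T` of the normalized code projection, up to a
factor that does not depend on `T`. -/
def purity (φ : Fin K → (ι → Fin D) → ℂ) (T : Finset ι) : ℂ :=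
  ∑ x, ∑ y, totalOverlap φ T x y * conj (totalOverlap φ T x y)

theorem card_mul_overlap {φ : Fin K → (ι → Fin D) → ℂ} {T : Finset ι} {x y : ι → Fin D}
    (h : ∃ c : ℂ, ∀ k l, overlap T (φ k) (φ l) x y = if k = l then c else 0) (k l : Fin K) :
    (K : ℂ) * overlap T (φ k) (φ l) x y = if k = l then totalOverlap φ T x y else 0 := by
  obtain ⟨c, hc⟩ := h
  simp [totalOverlap, hc]

/-- If the code corrects the erasure of `T`, then the purities of the reductions to `T` and to its
complement differ by the factor `K`. -/
theorem mul_purity_compl {φ : Fin K → (ι → Fin D) → ℂ} {T : Finset ι} (hK : K ≠ 0)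
    (h : ∀ x y, ∃ c : ℂ, ∀ k l, overlap T (φ k) (φ l) x y = if k = l then c else 0) :
    (K : ℂ) * purity φ Tᶜ = purity φ T := by
  have hK' : (K : ℂ) ≠ 0 := by exact_mod_cast hK
  have h1 : purity φ Tᶜ = ∑ k, ∑ l, ∑ x, ∑ y,
      overlap T (φ k) (φ l) x y * conj (overlap T (φ k) (φ l) x y) := by
    simp only [← sum_overlap_mul_conj_compl, purity, totalOverlap, map_sum, Finset.sum_mul_sum]
    rw [sum_rotate, sum_rotate]
    exact Finset.sum_congr rfl fun k _ => (sum_rotate _).symm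
  have h2 : ∀ k l, (K : ℂ) * (K * ∑ x, ∑ y,
      overlap T (φ k) (φ l) x y * conj (overlap T (φ k) (φ l) x y)) =
      if k = l then purity φ T else 0 := by
    intro k l
    have : ∀ x y, (K : ℂ) * (K * (overlap T (φ k) (φ l) x y *
        conj (overlap T (φ k) (φ l) x y))) = if k = l then
          totalOverlap φ T x y * conj (totalOverlap φ T x y) else 0 := by
      intro x y
      have := card_mul_overlap (h x y) k l
      calc _ = ((K : ℂ) * overlap T (φ k) (φ l) x y) *
            conj ((K : ℂ) * overlap T (φ k) (φ l) x y) := by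
            rw [map_mul, map_natCast]; ring
        _ = _ := by rw [this]; split_ifs <;> simp
    simp only [Finset.mul_sum, this]
    split_ifs <;> simp [purity]
  refine mul_left_cancel₀ hK' ?_
  rw [h1]
  simp only [Finset.mul_sum (s := (univ : Finset (Fin K))), h2]
  simp

/-- For disjoint sets `A`, `A'` of `r` parties, the reduction to the complement of `A` is the
reduction to `A'` tensored with the maximally mixed state on the remaining parties. -/
theorem totalOverlap_compl_eq {φ : Fin K → (ι → Fin D) → ℂ} (hD : D ≠ 0)
    (h : ∀ T : Finset ι, T.card ≤ r → ∀ x y, ∃ c : ℂ, ∀ k l,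
      overlap T (φ k) (φ l) x y = if k = l then c else 0)
    (hK : K = D ^ (Fintype.card ι - 2 * r)) {A A' : Finset ι} (hA : A.card = r)
    (hA' : A'.card = r) (hAA' : Disjoint A A') (x y : ι → Fin D) :
    totalOverlap φ Aᶜ x y = if ∀ i ∈ Aᶜ \ A', x i = y i then totalOverlap φ A' x y else 0 := by
  have : ∀ _ : ι, Nonempty (Fin D) := fun _ => ⟨⟨0, Nat.pos_of_ne_zero hD⟩⟩
  have hK0 : K ≠ 0 := hK ▸ pow_ne_zero _ hD
  -- The squared distance between the two sides is, up to a factor, the difference of the purities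
  -- of `A` and `A'`; it is nonnegative, and so is the one with `A` and `A'` exchanged.
  have key : ∀ A A' : Finset ι, A.card = r → A'.card = r → Disjoint A A' →
      (K : ℝ) * ∑ x, ∑ y, Complex.normSq (totalOverlap φ Aᶜ x y -
        if ∀ i ∈ Aᶜ \ A', x i = y i then totalOverlap φ A' x y else 0) =
      (purity φ A).re - (purity φ A').re := by
    intro A A' hA hA' hAA'
    have hsub : A' ⊆ Aᶜ := Finset.subset_compl_iff_disjoint_left.2 hAA'
    have hdisj : Disjoint A' (Aᶜ \ A') := Finset.disjoint_sdiff
    have hM : ∀ i, i ∈ Aᶜ ↔ i ∈ A' ∨ i ∈ Aᶜ \ A' := by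
      intro i
      have := @hsub i
      rw [Finset.mem_sdiff]
      tauto
    -- This is where the code attains the Singleton bound.
    have hcard : (∏ i ∈ Aᶜ \ A', (Fintype.card (Fin D) : ℂ)) = K := by
      rw [Finset.prod_const, Finset.card_sdiff_of_subset hsub, Finset.card_compl, hA, hA', hK,
        Fintype.card_fin, Nat.sub_sub, two_mul]
      push_cast
      rfl
    have e := sum_sub_indicator_mul_conj (Aᶜ \ A') (totalOverlap φ Aᶜ) (totalOverlap φ A')
      (fun w x y => totalOverlap_congr φ
        (fun i hi => Finset.piecewise_eq_of_notMem _ _ _ (Finset.disjoint_left.1 hdisj hi))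
        (fun i hi => Finset.piecewise_eq_of_notMem _ _ _ (Finset.disjoint_left.1 hdisj hi)))
      (fun x y => sum_totalOverlap_piecewise φ hM hdisj x y)
    rw [hcard] at e
    change _ = (K : ℂ) * purity φ Aᶜ - purity φ A' at e
    rw [mul_purity_compl hK0 (h A hA.le)] at e
    simp only [Complex.mul_conj] at e
    rw [← Complex.sub_re, ← e]
    norm_cast
  have hpos : (0 : ℝ) < K := by exact_mod_cast Nat.pos_of_ne_zero hK0
  have h0 : ∀ A A' : Finset ι, 0 ≤ ∑ x, ∑ y, Complex.normSq (totalOverlap φ Aᶜ x y -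
        if ∀ i ∈ Aᶜ \ A', x i = y i then totalOverlap φ A' x y else 0) := fun A A' =>
    Finset.sum_nonneg fun x _ => Finset.sum_nonneg fun y _ => Complex.normSq_nonneg _
  have k1 := key A A' hA hA' hAA'
  have k2 := key A' A hA' hA hAA'.symm
  have hz := le_antisymm (nonpos_of_mul_nonpos_right
    (by linarith [mul_nonneg hpos.le (h0 A' A)]) hpos) (h0 A A')
  rw [Finset.sum_eq_zero_iff_of_nonneg
    (fun x _ => Finset.sum_nonneg fun y _ => Complex.normSq_nonneg _)] at hz
  have hz' := (Finset.sum_eq_zero_iff_of_nonneg fun y _ => Complex.normSq_nonneg _).1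
    (hz x (mem_univ x)) y (mem_univ y)
  exact sub_eq_zero.1 (Complex.normSq_eq_zero.1 hz')

theorem totalOverlap_eq_of_card_eq {φ : Fin K → (ι → Fin D) → ℂ} (hD : D ≠ 0)
    (hφ : ∀ k l, ∑ z, φ k z * conj (φ l z) = if k = l then 1 else 0)
    (h : ∀ T : Finset ι, T.card ≤ r → ∀ x y, ∃ c : ℂ, ∀ k l,
      overlap T (φ k) (φ l) x y = if k = l then c else 0)
    (hr : 2 * r < Fintype.card ι) (hK : K = D ^ (Fintype.card ι - 2 * r))
    {M : Finset ι} (hM : M.card = Fintype.card ι - r) (x y : ι → Fin D) :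
    totalOverlap φ M x y = if ∀ i ∈ M, x i = y i then (K : ℂ) else 0 := by
  have hcompl : Mᶜ.card = r := by rw [Finset.card_compl, hM]; omega
  -- Since `2 * r < |ι|`, each party of `M` is missed by some `r`-subset of `M`.
  have step : ∀ i ∈ M, ∃ A', i ∉ A' ∧ ∀ x y, totalOverlap φ M x y =
      if ∀ j ∈ M \ A', x j = y j then totalOverlap φ A' x y else 0 := by
    intro i hi
    obtain ⟨A', hA'sub, hA'⟩ := Finset.exists_subset_card_eq (s := M.erase i) (n := r)
      (by rw [Finset.card_erase_of_mem hi]; omega)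
    refine ⟨A', fun hmem => Finset.notMem_erase i M (hA'sub hmem), fun x y => ?_⟩
    have hd : Disjoint Mᶜ A' := by
      rw [← Finset.subset_compl_iff_disjoint_left, compl_compl]
      exact hA'sub.trans (Finset.erase_subset _ _)
    simpa only [compl_compl] using totalOverlap_compl_eq hD h hK hcompl hA' hd x y
  have hupd : ∀ i (a : Fin D) (x : ι → Fin D),
      totalOverlap φ M (Function.update x i a) (Function.update x i a) =
        totalOverlap φ M x x := by
    intro i a x
    have hne : ∀ {S : Finset ι}, i ∉ S → ∀ j ∈ S, Function.update x i a j = x j :=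
      fun hS j hj => Function.update_of_ne (ne_of_mem_of_not_mem hj hS) _ _
    by_cases hi : i ∈ M
    · obtain ⟨A', hiA', hA'⟩ := step i hi
      rw [hA', hA', if_pos fun _ _ => rfl, if_pos fun _ _ => rfl]
      exact totalOverlap_congr φ (hne hiA') (hne hiA')
    · exact totalOverlap_congr φ (hne hi) (hne hi)
  have hconst : ∀ x y : ι → Fin D, totalOverlap φ M x x = totalOverlap φ M y y := by
    intro x y
    have : ∀ s : Finset ι, totalOverlap φ M (s.piecewise x y) (s.piecewise x y) =
        totalOverlap φ M y y := by
      intro s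
      induction s using Finset.induction_on with
      | empty => rw [Finset.piecewise_empty]
      | insert j s _ ih => rw [Finset.piecewise_insert, hupd, ih]
    simpa using this univ
  have hN : (Fintype.card (ι → Fin D) : ℂ) ≠ 0 := by
    have : Nonempty (Fin D) := ⟨⟨0, Nat.pos_of_ne_zero hD⟩⟩
    exact_mod_cast Fintype.card_ne_zero
  split_ifs with hxy
  · rw [totalOverlap_congr φ (y' := x) (fun _ _ => rfl) fun i hi => (hxy i hi).symm]
    refine mul_left_cancel₀ hN ?_
    calc _ = ∑ x, totalOverlap φ M x x := by
          rw [Finset.sum_congr rfl fun y _ => hconst y x]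
          simp
      _ = ∑ k : Fin K, (Fintype.card (ι → Fin D) : ℂ) * ∑ z, φ k z * conj (φ k z) := by
          simp only [totalOverlap]
          rw [Finset.sum_comm]
          simp only [sum_overlap_self]
      _ = _ := by simp [hφ, mul_comm]
  · push Not at hxy
    obtain ⟨i, hi, hne⟩ := hxy
    obtain ⟨A', hiA', hA'⟩ := step i hi
    rw [hA', if_neg fun hall => hne (hall i (Finset.mem_sdiff.2 ⟨hi, hiA'⟩))]

/-- The projection onto a quantum MDS code has maximally mixed reductions to all sets of at most
`n - r` parties. -/
theorem totalOverlap_eq {φ : Fin K → (ι → Fin D) → ℂ} (hD : D ≠ 0)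
    (hφ : ∀ k l, ∑ z, φ k z * conj (φ l z) = if k = l then 1 else 0)
    (h : ∀ T : Finset ι, T.card ≤ r → ∀ x y, ∃ c : ℂ, ∀ k l,
      overlap T (φ k) (φ l) x y = if k = l then c else 0)
    (hr : 2 * r < Fintype.card ι) (hK : K = D ^ (Fintype.card ι - 2 * r))
    {T : Finset ι} (hT : T.card ≤ Fintype.card ι - r) (x y : ι → Fin D) :
    totalOverlap φ T x y = if ∀ i ∈ T, x i = y i then (K : ℂ) else 0 := by
  obtain ⟨M, hTM, hM⟩ := Finset.exists_superset_card_eq hT (by omega)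
  have hN : (Fintype.card (ι → Fin D) : ℂ) ≠ 0 := by
    have : Nonempty (Fin D) := ⟨⟨0, Nat.pos_of_ne_zero hD⟩⟩
    exact_mod_cast Fintype.card_ne_zero
  refine mul_left_cancel₀ hN ?_
  have hmem : ∀ i, i ∈ M ↔ i ∈ T ∨ i ∈ M \ T := by
    intro i
    have := @hTM i
    rw [Finset.mem_sdiff]
    tauto
  rw [← sum_totalOverlap_piecewise φ hmem Finset.disjoint_sdiff]
  have hiff : ∀ w : ι → Fin D, (∀ i ∈ M, (M \ T).piecewise w x i = (M \ T).piecewise w y i) ↔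
      ∀ i ∈ T, x i = y i := by
    intro w
    refine ⟨fun hall i hi => ?_, fun hall i hi => ?_⟩
    · simpa [hi] using hall i (hTM hi)
    · by_cases hiT : i ∈ T
      · simpa [hiT] using hall i hiT
      · simp [hi, hiT]
  simp only [totalOverlap_eq_of_card_eq hD hφ h hr hK hM, hiff]
  simp

/-- A quantum MDS code of dimension greater than one is pure, all its reductions to at most `r`
parties being maximally mixed, and its projection has maximally mixed reductions to at most `n - r`
parties. -/
theorem IsQMDSCode.exists_overlap_eq {n : ℕ}
    {C : Submodule ℂ (StateSpace fun _ : Fin n => D)} (hC : IsQMDSCode C K (r + 1))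
    (hK : 1 < K) :
    1 < D ∧ 2 * r < n ∧ ∃ φ : Fin K → (Fin n → Fin D) → ℂ,
      (∀ T : Finset (Fin n), T.card ≤ r → ∀ x y k l, overlap T (φ k) (φ l) x y =
        if k = l ∧ ∀ i ∈ T, x i = y i then 1 else 0) ∧
      ∀ T : Finset (Fin n), T.card ≤ n - r → ∀ x y, totalOverlap φ T x y =
        if ∀ i ∈ T, x i = y i then (K : ℂ) else 0 := by
  obtain ⟨hcode, hsing⟩ := hC
  have hKR : (1 : ℝ) < (D : ℝ) ^ ((n : ℤ) - 2 * (((r + 1 : ℕ) : ℤ) - 1)) := by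
    rw [← hsing]; exact_mod_cast hK
  have hD : 1 < D := by
    by_contra hD
    interval_cases D
    · by_cases h0 : ((n : ℤ) - 2 * (((r + 1 : ℕ) : ℤ) - 1)) = 0
      · rw [h0, zpow_zero] at hKR
        exact absurd hKR (lt_irrefl _)
      · rw [Nat.cast_zero, zero_zpow _ h0] at hKR
        linarith
    · simp at hKR
  have hDR : (1 : ℝ) < D := by exact_mod_cast hD
  have hexp := (one_lt_zpow_iff_right₀ hDR).1 hKR
  have hr : 2 * r < n := by push_cast at hexp; omega
  have hKn : K = D ^ (Fintype.card (Fin n) - 2 * r) := by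
    have he : ((n : ℤ) - 2 * (((r + 1 : ℕ) : ℤ) - 1)) = ((n - 2 * r : ℕ) : ℤ) := by
      push_cast [hr.le]; ring
    rw [he, zpow_natCast] at hsing
    rw [Fintype.card_fin]
    exact_mod_cast hsing
  obtain ⟨φ, hφ, h⟩ := exists_overlap_eq_of_isQuantumCode hcode
  have htot := fun (T : Finset (Fin n)) hT x y => totalOverlap_eq (T := T) (by omega) hφ h
    (by simpa using hr) hKn hT x y
  simp only [Fintype.card_fin] at htot
  refine ⟨hD, hr, φ, fun T hT x y k l => ?_, fun T hT x y => by convert htot T hT x y⟩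
  have hK0 : (K : ℂ) ≠ 0 := by exact_mod_cast (by omega : K ≠ 0)
  refine mul_left_cancel₀ hK0 ?_
  rw [card_mul_overlap (h T hT x y), htot T (by omega)]
  split_ifs <;> simp_all

end Code

/-! ### Projecting parties onto basis states -/

section Shortening

variable {ι κ ν : Type*} [Fintype κ] {D K : ℕ}

theorem forall_mem_map_disjSum_univ_iff (e : ι ⊕ κ ≃ ν) (S : Finset ι) (s t : κ → Fin D)
    (x y : ι → Fin D) :
    (∀ i ∈ (S.disjSum univ).map e.toEmbedding,
      (Sum.elim x s ∘ e.symm) i = (Sum.elim y t ∘ e.symm) i) ↔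
      s = t ∧ ∀ i ∈ S, x i = y i := by
  simp only [Finset.mem_map_equiv, Function.comp_apply, e.symm.forall_congr_left,
    Equiv.symm_symm, Equiv.symm_apply_apply, Sum.forall, Finset.inl_mem_disjSum,
    Finset.inr_mem_disjSum, mem_univ, forall_const, Sum.elim_inl, Sum.elim_inr, funext_iff]
  exact and_comm

variable [Fintype ι] [DecidableEq ι] [Fintype ν] [DecidableEq ν]

/-- The unnormalized state `⟨s|f⟩` of the parties `ι` that remains when the parties `κ` of a system
`ν ≃ ι ⊕ κ` are projected onto the basis state `s`. -/
def contract (e : ι ⊕ κ ≃ ν) (f : (ν → Fin D) → ℂ) (s : κ → Fin D) (x : ι → Fin D) : ℂ :=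
  f (Sum.elim x s ∘ e.symm)

/-- The reduction of `⟨s|f⟩`, `⟨t|g⟩` to `S` is the block `(s, t)` of the reduction of `f`, `g` to the
union of `S` and the projected parties. -/
theorem pow_mul_overlap_contract (e : ι ⊕ κ ≃ ν) (S : Finset ι) (f g : (ν → Fin D) → ℂ)
    (s t : κ → Fin D) (x y : ι → Fin D) :
    (D : ℂ) ^ Fintype.card κ * overlap S (contract e f s) (contract e g t) x y =
      overlap ((S.disjSum univ).map e.toEmbedding) f g (Sum.elim x s ∘ e.symm)
        (Sum.elim y t ∘ e.symm) := by
  classical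
  let E : (ι → Fin D) × (κ → Fin D) ≃ (ν → Fin D) :=
    (Equiv.sumArrowEquivProdArrow ι κ (Fin D)).symm.trans (e.arrowCongr (Equiv.refl _))
  have hE : ∀ (x z : ι → Fin D) (s u : κ → Fin D),
      ((S.disjSum univ).map e.toEmbedding).piecewise (Sum.elim x s ∘ e.symm) (E (z, u)) =
        Sum.elim (S.piecewise x z) s ∘ e.symm := by
    intro x z s u
    funext i
    obtain ⟨j, rfl⟩ := e.surjective i
    have hE' : E (z, u) (e j) = Sum.elim z u j := by simp [E, Equiv.sumArrowEquivProdArrow]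
    by_cases hj : j ∈ S.disjSum univ
    · have hj' : e j ∈ (S.disjSum univ).map e.toEmbedding :=
        Finset.mem_map_of_mem e.toEmbedding hj
      rw [Finset.piecewise_eq_of_mem _ _ _ hj']
      rcases j with j | j
      · have : j ∈ S := by simpa using hj
        simp [this]
      · simp
    · rw [Finset.piecewise_eq_of_notMem _ _ _ (by simpa using hj), hE']
      rcases j with j | j
      · have : j ∉ S := by simpa using hj
        simp [this]
      · simp at hj
  simp only [overlap]
  rw [← E.sum_comp, Fintype.sum_prod_type]
  simp only [hE, contract, Finset.sum_const, Finset.mul_sum]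
  simp

/-- The reductions of a quantum MDS code after projecting `α` parties onto basis states `s`, `t`:
here `Φ s k` is the projection `⟨s|φ k⟩` of the `k`-th vector of a basis. -/
theorem IsQMDSCode.exists_contract {n r : ℕ}
    {C : Submodule ℂ (StateSpace fun _ : Fin n => D)} (hC : IsQMDSCode C K (r + 1))
    (hK : 1 < K) {α : ℕ} (hα : α ≤ r) :
    ∃ Φ : (Fin α → Fin D) → Fin K → (Fin (n - α) → Fin D) → ℂ,
      (∀ S : Finset (Fin (n - α)), S.card + α ≤ r → ∀ s t k l x y,
        (D : ℂ) ^ α * overlap S (Φ s k) (Φ t l) x y =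
          if k = l ∧ s = t ∧ ∀ i ∈ S, x i = y i then 1 else 0) ∧
      ∀ S : Finset (Fin (n - α)), S.card + α ≤ n - r → ∀ s t x y,
        (D : ℂ) ^ α * ∑ k, overlap S (Φ s k) (Φ t k) x y =
          if s = t ∧ ∀ i ∈ S, x i = y i then (K : ℂ) else 0 := by
  obtain ⟨-, hr, φ, h₁, h₂⟩ := hC.exists_overlap_eq hK
  let e : Fin (n - α) ⊕ Fin α ≃ Fin n := finSumFinEquiv.trans (finCongr (by omega))
  have hcard : ∀ S : Finset (Fin (n - α)),
      ((S.disjSum (univ : Finset (Fin α))).map e.toEmbedding).card = S.card + α := by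
    intro S
    simp
  refine ⟨fun s k => contract e (φ k) s, fun S hS s t k l x y => ?_, fun S hS s t x y => ?_⟩
  · have := pow_mul_overlap_contract e S (φ k) (φ l) s t x y
    rw [Fintype.card_fin, h₁ _ (by rwa [hcard])] at this
    simp only [forall_mem_map_disjSum_univ_iff] at this
    exact this
  · have : ∀ k, _ := fun k => pow_mul_overlap_contract e S (φ k) (φ k) s t x y
    simp only [Fintype.card_fin] at this
    rw [Finset.mul_sum]
    simp only [this]
    have h := h₂ _ ((hcard S).trans_le hS) (Sum.elim x s ∘ e.symm) (Sum.elim y t ∘ e.symm)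
    simp only [forall_mem_map_disjSum_univ_iff] at h
    exact h

end Shortening

/-! ### Entangling two codes -/

section Tensor

variable {ι₁ ι₂ : Type*} [Fintype ι₁] [Fintype ι₂] [DecidableEq ι₁] [DecidableEq ι₂] {D₁ D₂ : ℕ}

/-- The entries of an index of a bipartite system that belong to the first group of parties. -/
def leftPart (v : ∀ i : ι₁ ⊕ ι₂, Fin (Sum.elim (fun _ => D₁) (fun _ => D₂) i)) : ι₁ → Fin D₁ :=
  fun i => v (Sum.inl i)

/-- The entries of an index of a bipartite system that belong to the second group of parties. -/
def rightPart (v : ∀ i : ι₁ ⊕ ι₂, Fin (Sum.elim (fun _ => D₁) (fun _ => D₂) i)) : ι₂ → Fin D₂ :=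
  fun j => v (Sum.inr j)

/-- The tensor product of a vector of each of two systems, as a vector of the joint system. -/
def tensor (f : (ι₁ → Fin D₁) → ℂ) (g : (ι₂ → Fin D₂) → ℂ)
    (v : ∀ i : ι₁ ⊕ ι₂, Fin (Sum.elim (fun _ => D₁) (fun _ => D₂) i)) : ℂ :=
  f (leftPart v) * g (rightPart v)

theorem overlap_tensor (S : Finset (ι₁ ⊕ ι₂)) (f f' : (ι₁ → Fin D₁) → ℂ)
    (g g' : (ι₂ → Fin D₂) → ℂ)
    (x y : ∀ i : ι₁ ⊕ ι₂, Fin (Sum.elim (fun _ => D₁) (fun _ => D₂) i)) :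
    overlap S (tensor f g) (tensor f' g') x y =
      overlap S.toLeft f f' (leftPart x) (leftPart y) *
        overlap S.toRight g g' (rightPart x) (rightPart y) := by
  let E : (ι₁ → Fin D₁) × (ι₂ → Fin D₂) ≃
      (∀ i : ι₁ ⊕ ι₂, Fin (Sum.elim (fun _ => D₁) (fun _ => D₂) i)) :=
    (Equiv.sumPiEquivProdPi fun i : ι₁ ⊕ ι₂ =>
      Fin (Sum.elim (fun _ => D₁) (fun _ => D₂) i)).symm
  have hl : ∀ (x : ∀ i : ι₁ ⊕ ι₂, Fin (Sum.elim (fun _ => D₁) (fun _ => D₂) i)) z w,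
      leftPart (S.piecewise x (E (z, w))) =
        S.toLeft.piecewise (leftPart x) z := by
    intro x z w
    funext i
    by_cases hi : Sum.inl i ∈ S
    · rw [Finset.piecewise_eq_of_mem _ _ _ (Finset.mem_toLeft.2 hi)]
      exact Finset.piecewise_eq_of_mem _ _ _ hi
    · rw [Finset.piecewise_eq_of_notMem _ _ _ (mt Finset.mem_toLeft.1 hi)]
      exact Finset.piecewise_eq_of_notMem _ _ _ hi
  have hr : ∀ (x : ∀ i : ι₁ ⊕ ι₂, Fin (Sum.elim (fun _ => D₁) (fun _ => D₂) i)) z w,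
      rightPart (S.piecewise x (E (z, w))) =
        S.toRight.piecewise (rightPart x) w := by
    intro x z w
    funext i
    by_cases hi : Sum.inr i ∈ S
    · rw [Finset.piecewise_eq_of_mem _ _ _ (Finset.mem_toRight.2 hi)]
      exact Finset.piecewise_eq_of_mem _ _ _ hi
    · rw [Finset.piecewise_eq_of_notMem _ _ _ (mt Finset.mem_toRight.1 hi)]
      exact Finset.piecewise_eq_of_notMem _ _ _ hi
  simp only [overlap]
  rw [← E.sum_comp, Fintype.sum_prod_type, Finset.sum_mul_sum]
  refine Finset.sum_congr rfl fun z _ => Finset.sum_congr rfl fun w _ => ?_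
  simp only [tensor, hl, hr, map_mul]
  ring

/-- The vector `∑ k, Φ s k ⊗ X t k`, where `p = (s, t)`. For `Φ s k = ⟨s|φ k⟩` and
`X t k = ⟨t|χ k⟩` it is the projection onto the basis state `|s⟩ ⊗ |t⟩` of the (unnormalized)
maximally entangled state `∑ k, φ k ⊗ χ k` of the two code spaces. -/
def entangledState {σ τ : Type*} {K : ℕ} (Φ : σ → Fin K → (ι₁ → Fin D₁) → ℂ)
    (X : τ → Fin K → (ι₂ → Fin D₂) → ℂ) (p : σ × τ)
    (v : ∀ i : ι₁ ⊕ ι₂, Fin (Sum.elim (fun _ => D₁) (fun _ => D₂) i)) : ℂ :=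
  ∑ k, tensor (Φ p.1 k) (X p.2 k) v

theorem overlap_entangledState {σ τ : Type*} {K : ℕ} (Φ : σ → Fin K → (ι₁ → Fin D₁) → ℂ)
    (X : τ → Fin K → (ι₂ → Fin D₂) → ℂ) (S : Finset (ι₁ ⊕ ι₂)) (p q : σ × τ)
    (x y : ∀ i : ι₁ ⊕ ι₂, Fin (Sum.elim (fun _ => D₁) (fun _ => D₂) i)) :
    overlap S (entangledState Φ X p) (entangledState Φ X q) x y =
      ∑ k, ∑ l,
        overlap S.toLeft (Φ p.1 k) (Φ q.1 l) (leftPart x) (leftPart y) *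
        overlap S.toRight (X p.2 k) (X q.2 l) (rightPart x)
          (rightPart y) := by
  have h := overlap_sum_mul S (fun _ : Fin K => (1 : ℂ)) (fun _ : Fin K => (1 : ℂ))
    (fun k => tensor (Φ p.1 k) (X p.2 k)) (fun k => tensor (Φ q.1 k) (X q.2 k)) x y
  simp only [one_mul, map_one, overlap_tensor] at h
  exact h

end Tensor

/-! ### Uniform subspaces -/

section Uniform

theorem prod_mul_reduction_dyad {ι : Type*} [Fintype ι] [DecidableEq ι] {d : ι → ℕ}
    (S : Finset ι) (ψ : StateSpace d) (x y : ∀ i : {i // i ∈ S}, Fin (d i))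
    (z₀ : ∀ i : {i // i ∉ S}, Fin (d i)) :
    (∏ i ∈ S, (d i : ℂ)) * reduction S (dyad ψ) x y =
      overlap S (fun v => ψ v) (fun v => ψ v) (glueIndex S x z₀) (glueIndex S y z₀) := by
  let E : (∀ i : {i // i ∈ S}, Fin (d i)) × (∀ i : {i // i ∉ S}, Fin (d i)) ≃
      (∀ i, Fin (d i)) := (Equiv.piEquivPiSubtypeProd (· ∈ S) fun i => Fin (d i)).symm
  have hE : ∀ x u z, S.piecewise (glueIndex S x z₀) (E (u, z)) = glueIndex S x z := by
    intro x u z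
    funext i
    by_cases hi : i ∈ S
    · rw [Finset.piecewise_eq_of_mem _ _ _ hi, glueIndex, glueIndex, dif_pos hi, dif_pos hi]
    · rw [Finset.piecewise_eq_of_notMem _ _ _ hi, glueIndex, dif_neg hi]
      exact dif_neg hi
  have hcard : (Fintype.card (∀ i : {i // i ∈ S}, Fin (d i)) : ℂ) = ∏ i ∈ S, (d i : ℂ) := by
    rw [Fintype.card_pi]
    push_cast
    simp only [Fintype.card_fin]
    exact Finset.prod_coe_sort S fun i => (d i : ℂ)
  rw [overlap, ← E.sum_comp, Fintype.sum_prod_type]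
  simp only [hE, Finset.sum_const, card_univ, nsmul_eq_mul, hcard]
  rfl

theorem isUniformState_of_overlap {ι : Type*} [Fintype ι] [DecidableEq ι] {d : ι → ℕ}
    (hd : ∀ i, d i ≠ 0) {l : ℕ} {ψ : StateSpace d} (hψ : ‖ψ‖ = 1)
    (h : ∀ S : Finset ι, S.card = l → ∀ x y, overlap S (fun v => ψ v) (fun v => ψ v) x y =
      if ∀ i ∈ S, x i = y i then 1 else 0) :
    IsUniformState l ψ := by
  refine ⟨hψ, fun S hS => ?_⟩
  have hprod : ∏ i ∈ S, (d i : ℂ) ≠ 0 :=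
    Finset.prod_ne_zero_iff.2 fun i _ => by exact_mod_cast hd i
  ext x y
  rw [Matrix.smul_apply, smul_eq_mul, eq_inv_mul_iff_mul_eq₀ hprod,
    prod_mul_reduction_dyad S ψ x y fun i => ⟨0, Nat.pos_of_ne_zero (hd i)⟩, h S hS,
    Matrix.one_apply]
  refine if_congr ⟨fun hxy => funext fun i => ?_, fun hxy i hi => ?_⟩ rfl rfl
  · simpa [glueIndex, i.2] using hxy i i.2
  · simp [glueIndex, hi, hxy]

/-- If `L` sends every `a` to a vector all of whose reductions to at most `l` parties are multiples
of the identity, with the same constant `c / N`, then it is a multiple of an isometry (take no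
parties) and its range is an `l`-uniform subspace. -/
theorem isUniformSubspace_range_of_overlap {ι P : Type*} [Fintype ι] [DecidableEq ι] {d : ι → ℕ}
    [Fintype P] (hd : ∀ i, d i ≠ 0) {l : ℕ} (L : (P → ℂ) →ₗ[ℂ] StateSpace d) {N c : ℂ}
    (hN : N ≠ 0) (hc : c ≠ 0)
    (h : ∀ S : Finset ι, S.card ≤ l → ∀ a x y, N * overlap S (fun v => L a v) (fun v => L a v) x y =
      if ∀ i ∈ S, x i = y i then c * ∑ p, a p * conj (a p) else 0) :
    Module.finrank ℂ (LinearMap.range L) = Fintype.card P ∧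
      IsUniformSubspace l (LinearMap.range L) := by
  have hnorm : ∀ a, N * ((‖L a‖ ^ 2 : ℝ) : ℂ) = c * ∑ p, a p * conj (a p) := by
    intro a
    have := h ∅ (by simp) a (fun i => ⟨0, Nat.pos_of_ne_zero (hd i)⟩)
      (fun i => ⟨0, Nat.pos_of_ne_zero (hd i)⟩)
    rw [overlap_empty, if_pos (by simp)] at this
    rw [← this, EuclideanSpace.norm_sq_eq]
    push_cast
    simp only [Complex.mul_conj, Complex.normSq_eq_norm_sq]
    push_cast
    rfl
  refine ⟨?_, ?_⟩
  · rw [LinearMap.finrank_range_of_inj, Module.finrank_pi]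
    rw [← LinearMap.ker_eq_bot, LinearMap.ker_eq_bot']
    intro a ha
    have h0 := hnorm a
    rw [ha, norm_zero] at h0
    have h1 : ∑ p, Complex.normSq (a p) = 0 := by
      have : ∑ p, a p * conj (a p) = 0 := by simpa [hc] using h0.symm
      simp only [Complex.mul_conj] at this
      exact_mod_cast this
    funext p
    exact Complex.normSq_eq_zero.1
      ((Finset.sum_eq_zero_iff_of_nonneg fun p _ => Complex.normSq_nonneg _).1 h1 p (mem_univ p))
  · rintro _ ⟨a, rfl⟩ ha
    refine isUniformState_of_overlap hd ha fun S hS x y => mul_left_cancel₀ hN ?_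
    rw [h S hS.le, ← hnorm a, ha]
    simp

end Uniform

/-- Knill–Laflamme for the entries `a k l` of one code, at a position that is on the diagonal iff `P`,
leaves of the entries `b k l` of the other code only their trace over the basis. -/
theorem sum_sum_ite_mul {K : ℕ} {P Q : Prop} [Decidable P] [Decidable Q] {c : ℂ}
    {a b : Fin K → Fin K → ℂ} (ha : ∀ k l, a k l = if k = l ∧ P then 1 else 0)
    (hb : ∑ k, b k k = if Q then c else 0) :
    ∑ k, ∑ l, a k l * b k l = if P ∧ Q then c else 0 := by
  simp only [ha, ite_and, ite_mul, one_mul, zero_mul, Finset.sum_ite_eq, mem_univ, if_true]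
  split_ifs <;> simp_all

/-- The uniform subspace is the range of the map sending the coefficients `a` to the vector
`∑ p, a p • entangledState Φ X p`, that is, to the projection of the entangled state of the two
codes onto the vector with coefficients `conj a` of the projected `α + β` parties. -/
theorem exists_uniformSubspace (n₁ n₂ D₁ D₂ K r₁ r₂ : ℕ)
    {C₁ : Submodule ℂ (StateSpace fun _ : Fin n₁ => D₁)}
    {C₂ : Submodule ℂ (StateSpace fun _ : Fin n₂ => D₂)}
    (hC₁ : IsQMDSCode C₁ K (r₁ + 1)) (hC₂ : IsQMDSCode C₂ K (r₂ + 1)) (hK : 1 < K)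
    {α β : ℕ} (hα : α ≤ r₁) (hβ : β ≤ r₂) {l : ℕ} (hl₁ : l + α ≤ n₁ - r₁)
    (hl₂ : l + β ≤ n₂ - r₂) (hl : l + α + β ≤ r₁ + r₂ + 1) :
    ∃ W : Submodule ℂ (StateSpace (Sum.elim (fun _ : Fin (n₁ - α) => D₁)
        (fun _ : Fin (n₂ - β) => D₂))),
      Module.finrank ℂ W = D₁ ^ α * D₂ ^ β ∧ IsUniformSubspace l W := by
  obtain ⟨hD₁, -, -⟩ := hC₁.exists_overlap_eq hK
  obtain ⟨hD₂, -, -⟩ := hC₂.exists_overlap_eq hK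
  obtain ⟨Φ, hΦ, hΦ'⟩ := hC₁.exists_contract hK hα
  obtain ⟨X, hX, hX'⟩ := hC₂.exists_contract hK hβ
  have hψ : ∀ S : Finset (Fin (n₁ - α) ⊕ Fin (n₂ - β)), S.card ≤ l → ∀ p q x y,
      ((D₁ : ℂ) ^ α * (D₂ : ℂ) ^ β) *
        overlap S (entangledState Φ X p) (entangledState Φ X q) x y =
      if p = q then if ∀ i ∈ S, x i = y i then (K : ℂ) else 0 else 0 := by
    intro S hS p q x y
    have hcard := S.card_toLeft_add_card_toRight
    have hiff : (p = q ∧ ∀ i ∈ S, x i = y i) ↔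
        (p.1 = q.1 ∧ ∀ i ∈ S.toLeft, leftPart x i = leftPart y i) ∧
          p.2 = q.2 ∧ ∀ j ∈ S.toRight, rightPart x j = rightPart y j := by
      simp only [Sum.forall, Finset.mem_toLeft, Finset.mem_toRight, Prod.ext_iff, leftPart,
        rightPart]
      tauto
    have hmul : ∀ a b : Fin K → Fin K → ℂ, ((D₁ : ℂ) ^ α * (D₂ : ℂ) ^ β) * ∑ k, ∑ l, a k l * b k l =
        ∑ k, ∑ l, ((D₁ : ℂ) ^ α * a k l) * ((D₂ : ℂ) ^ β * b k l) := by
      intro a b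
      simp only [Finset.mul_sum]
      exact Finset.sum_congr rfl fun k _ => Finset.sum_congr rfl fun l _ => by ring
    rw [overlap_entangledState, hmul, ← ite_and]
    -- The bound `l + α + β ≤ r₁ + r₂ + 1` excludes that both codes are reduced to more parties than
    -- their purity allows.
    rcases le_or_gt (S.toLeft.card + α) r₁ with h | h
    · rw [sum_sum_ite_mul (fun k l => hΦ _ h _ _ k l _ _)
        (by rw [← Finset.mul_sum]; exact hX' _ (by omega) _ _ _ _)]
      exact if_congr hiff.symm rfl rfl
    · simp only [mul_comm ((D₁ : ℂ) ^ α * _)]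
      rw [sum_sum_ite_mul (fun k l => hX _ (by omega) _ _ k l _ _)
        (by rw [← Finset.mul_sum]; exact hΦ' _ (by omega) _ _ _ _)]
      exact if_congr (and_comm.trans hiff.symm) rfl rfl
  let L : ((Fin α → Fin D₁) × (Fin β → Fin D₂) → ℂ) →ₗ[ℂ]
      StateSpace (Sum.elim (fun _ : Fin (n₁ - α) => D₁) (fun _ : Fin (n₂ - β) => D₂)) :=
    { toFun := fun a => WithLp.toLp 2 fun v => ∑ p, a p * entangledState Φ X p v
      map_add' := fun a b => by
        ext v
        simp [add_mul, Finset.sum_add_distrib]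
      map_smul' := fun c a => by
        ext v
        simp [Finset.mul_sum, mul_assoc] }
  have hN : (D₁ : ℂ) ^ α * (D₂ : ℂ) ^ β ≠ 0 :=
    mul_ne_zero (pow_ne_zero _ (by exact_mod_cast (by omega : D₁ ≠ 0)))
      (pow_ne_zero _ (by exact_mod_cast (by omega : D₂ ≠ 0)))
  have hd : ∀ i, Sum.elim (fun _ : Fin (n₁ - α) => D₁) (fun _ : Fin (n₂ - β) => D₂) i ≠ 0 := by
    rintro (i | i)
    · exact (by omega : D₁ ≠ 0)
    · exact (by omega : D₂ ≠ 0)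
  have hW := isUniformSubspace_range_of_overlap hd (l := l) L hN
    (c := K) (by exact_mod_cast (by omega : K ≠ 0)) (fun S hS a x y => by
      have h := overlap_sum_mul S a a (entangledState Φ X) (entangledState Φ X) x y
      change _ * overlap S (fun v => ∑ p, a p * entangledState Φ X p v)
        (fun v => ∑ p, a p * entangledState Φ X p v) x y = _
      rw [h]
      simp only [Finset.mul_sum, mul_left_comm (_ * _ : ℂ) (_ * conj _)]
      simp only [hψ S hS]
      split_ifs <;> simp [mul_comm])
  refine ⟨LinearMap.range L, ?_, hW.2⟩
  rw [hW.1]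
  simp

theorem corollary2 (n₁ n₂ D₁ D₂ K₁ K₂ d₁ d₂ r₁ r₂ : ℕ)
    (C₁ : Submodule ℂ (StateSpace fun _ : Fin n₁ => D₁))
    (C₂ : Submodule ℂ (StateSpace fun _ : Fin n₂ => D₂))
    (hC₁ : IsQMDSCode C₁ K₁ d₁) (hC₂ : IsQMDSCode C₂ K₂ d₂)
    (hK : K₁ = K₂) (hK_gt : 1 < K₁)
    (hr₁ : d₁ = r₁ + 1) (hr₂ : d₂ = r₂ + 1)
    (α β : ℕ) (hα : α ≤ r₁) (hβ : β ≤ r₂) :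
    ∃ l : ℕ,
      (l : ℤ) = min (min ((n₁ : ℤ) - r₁ - α) ((n₂ : ℤ) - r₂ - β))
        ((r₁ : ℤ) + r₂ + 1 - α - β) ∧
      ∃ W : Submodule ℂ (StateSpace (Sum.elim (fun _ : Fin (n₁ - α) => D₁)
          (fun _ : Fin (n₂ - β) => D₂))),
        Module.finrank ℂ W = D₁ ^ α * D₂ ^ β ∧ IsUniformSubspace l W := by
  subst hK hr₁ hr₂
  -- `2 * r₁ < n₁` and `2 * r₂ < n₂`: the three terms of the minimum are positive.
  obtain ⟨-, h₁, -⟩ := hC₁.exists_overlap_eq hK_gt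
  obtain ⟨-, h₂, -⟩ := hC₂.exists_overlap_eq hK_gt
  exact ⟨min (min (n₁ - r₁ - α) (n₂ - r₂ - β)) (r₁ + r₂ + 1 - α - β), by omega,
    exists_uniformSubspace n₁ n₂ D₁ D₂ K₁ r₁ r₂ hC₁ hC₂ hK_gt hα hβ (by omega) (by omega)
      (by omega)⟩
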